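/- Let $G=(V,E,c)$ be a finite connected undirected graph (loops and parallel edges allowed) with a fixed planar embedding and edge capacities $c:E\to\mathbb{R}_{\ge 0}$. Let $G_D$ be its embedded dual graph, whose vertices are the faces of $G$, whose faces are the vertices of $G$, and in which each dual edge has length equal to the capacity of its primal edge. Let $s,t\in V$, and let $\pi$ be a simple path in $G_D$ traversing pairwise distinct dual vertices $f_1,\dots,f_k$, where $f_1$ is incident to $s$ and $f_k$ is incident to $t$. For a simple cycle $C$ in $G_D$ (possibly a loop or a pair of parallel edges), the cost $c(C)$ is the sum of the lengths of its edges, and $\mathrm{int}(C)$ is the region inside $C$, including $C$ itself; here the embedding is drawn with $t$ in the unbounded face of $G_D$, so the inside of $C$ is the side of $C$ not containing $t$. The cycle $C$ is a cut-cycle if $\mathrm{int}(C)$ contains $s$ but not $t$ (so $C$ separates $s$ from $t$, and $\mathrm{int}(C)$ is its closed side containing $s$). It is an $f_i$-cut-cycle if it is a cut-cycle that passes through $f_i$ and through no $f_j$ with $j>i$. It is a minimum $f_i$-cut-cycle if moreover its cost is minimum among all $f_i$-cut-cycles. Let $1\le i<j\le k$, let $C_i$ be a minimum $f_i$-cut-cycle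 and let $C_j$ be a minimum $f_j$-cut-cycle. Then for some $i'\le i$ there exists a minimum $f_{i'}$-cut-cycle $C_{i'}\subseteq\mathrm{int}(C_j)$ such that $c(C_{i'})\le c(C_i)$. -/

import Mathlib

/-- A connected undirected graph `G` (loops and parallel edges are allowed) with a planar embedding,
given by its rotation system on the type `D` of darts (oriented edges). `rot d` is the next dart
counterclockwise around the origin of `d`, and `rev d` is `d` with the opposite orientation. -/
structure PlaneGraph (D : Type*) where
  rot : Equiv.Perm D
  rev : Equiv.Perm D
  rev_rev : ∀ d, rev (rev d) = d
  rev_ne : ∀ d, rev d ≠ d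
  /-- The graph is connected. -/
  connected : ∀ a b : D, ∃ g ∈ Subgroup.closure {rot, rev}, g a = b
  /-- Euler's formula: the surface is the sphere. The orbits of `rot`, `rev` and `rot⁻¹ * rev` are
  the vertices, the edges and the faces. -/
  euler : Nat.card (Quotient (Equiv.Perm.SameCycle.setoid rot)) +
      Nat.card (Quotient (Equiv.Perm.SameCycle.setoid (rot⁻¹ * rev))) =
    Nat.card (Quotient (Equiv.Perm.SameCycle.setoid rev)) + 2

namespace PlaneGraph

variable {D : Type*} (G : PlaneGraph D)

/-- The next dart along the face to the left of a dart. -/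
def facePerm : Equiv.Perm D := G.rot⁻¹ * G.rev

/-- Vertices of `G`, that is, faces of the dual graph. -/
abbrev Vertex : Type _ := Quotient (Equiv.Perm.SameCycle.setoid G.rot)

/-- Edges of `G`; each is also an edge of the dual graph. -/
abbrev Edge : Type _ := Quotient (Equiv.Perm.SameCycle.setoid G.rev)

/-- Faces of `G`, that is, vertices of the dual graph. -/
abbrev Face : Type _ := Quotient (Equiv.Perm.SameCycle.setoid G.facePerm)

/-- The vertex from which a dart emanates. -/
def vertexOf (d : D) : G.Vertex := Quotient.mk _ d

/-- The edge underlying a dart. -/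
def edgeOf (d : D) : G.Edge := Quotient.mk _ d

/-- The face to the left of a dart. The dual of the edge of `d` joins `faceOf d`
and `faceOf (rev d)`. -/
def faceOf (d : D) : G.Face := Quotient.mk _ d

/-- A vertex and a face of `G` are incident. -/
def Incident (v : G.Vertex) (f : G.Face) : Prop :=
  ∃ d, G.vertexOf d = v ∧ G.faceOf d = f

/-- Two faces of `G` are joined by an edge of the dual graph. -/
def DualAdj (f g : G.Face) : Prop :=
  ∃ d, G.faceOf d = f ∧ G.faceOf (G.rev d) = g

/-- A simple cycle, of length `n + 1 ≥ 1`, in the dual graph. It passes through the pairwise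
distinct faces `faceOf (dart m)` and uses the pairwise distinct edges `edgeOf (dart m)`; the
indices are cyclic (`Fin.last n + 1 = 0`). Length 1 is a loop, and length 2 is a pair of parallel
edges. -/
structure DualCycle where
  n : ℕ
  dart : Fin (n + 1) → D
  closed : ∀ m, G.faceOf (G.rev (dart m)) = G.faceOf (dart (m + 1))
  faces_inj : Function.Injective fun m => G.faceOf (dart m)
  edges_inj : Function.Injective fun m => G.edgeOf (dart m)

/-- The cells of the embedded dual graph: its vertices, its edges, and its faces. -/
inductive Cell
  | dualVertex (f : G.Face)
  | dualEdge (e : G.Edge)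
  | dualFace (v : G.Vertex)

variable {G}

namespace DualCycle

variable (C : G.DualCycle)

/-- The vertices of the dual graph (faces of `G`) on the cycle. -/
def faces : Set G.Face := Set.range fun m => G.faceOf (C.dart m)

/-- The edges on the cycle. -/
def edges : Set G.Edge := Set.range fun m => G.edgeOf (C.dart m)

/-- The cycle as a set of cells. -/
def cells : Set G.Cell := Cell.dualVertex '' C.faces ∪ Cell.dualEdge '' C.edges

/-- The total length of the edges on the cycle. -/
def cost (c : G.Edge → ℝ) : ℝ := ∑ m, c (G.edgeOf (C.dart m))

/-- Two faces of the dual graph lie in the same region of the complement of `C`: one passes from one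
to the other by crossing dual edges that are not on `C`, i.e. along edges of `G`. -/
def SameRegion : G.Vertex → G.Vertex → Prop :=
  Relation.ReflTransGen fun u v =>
    ∃ d, G.vertexOf d = u ∧ G.vertexOf (G.rev d) = v ∧ G.edgeOf d ∉ C.edges

/-- The faces of the dual graph inside `C`, where `o` is the outer face of the dual graph. -/
def inside (o : G.Vertex) : Set G.Vertex := {v | ¬ C.SameRegion o v}

/-- The interior of `C`, where `o` is the outer face of the dual graph: the region inside `C`,
including `C` itself. -/
def interior (o : G.Vertex) : Set G.Cell :=
  C.cells ∪
    (Cell.dualFace '' C.inside o ∪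
      Cell.dualEdge '' {e | ∃ d, G.edgeOf d = e ∧ G.vertexOf d ∈ C.inside o} ∪
      Cell.dualVertex '' {f | ∃ v ∈ C.inside o, G.Incident v f})

/-- `C` is a cut-cycle: its interior contains `s` and not `t`. The embedding is drawn with `t` in
the outer face of the dual graph, so that the interior of a cycle separating `s` from `t` is its
side containing `s`. -/
def IsCutCycle (s t : G.Vertex) : Prop :=
  Cell.dualFace s ∈ C.interior t ∧ Cell.dualFace t ∉ C.interior t

end DualCycle

variable (G) in
/-- A simple path `f 0, …, f n` in the dual graph, from a face incident to `s` to a face incident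
to `t`. -/
structure DualPath (s t : G.Vertex) (n : ℕ) where
  f : Fin (n + 1) → G.Face
  adj : ∀ m : Fin n, G.DualAdj (f m.castSucc) (f m.succ)
  inj : Function.Injective f
  start : G.Incident s (f 0)
  finish : G.Incident t (f (Fin.last n))

namespace DualCycle

variable {s t : G.Vertex} {n : ℕ}

/-- An `f_i`-cut-cycle with respect to the path `π`. -/
def IsFCutCycle (C : G.DualCycle) (π : G.DualPath s t n) (i : Fin (n + 1)) : Prop :=
  C.IsCutCycle s t ∧ π.f i ∈ C.faces ∧ ∀ j, i < j → π.f j ∉ C.faces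

/-- A minimum `f_i`-cut-cycle with respect to the path `π` and the capacities `c`. -/
def IsMinFCutCycle (C : G.DualCycle) (c : G.Edge → ℝ) (π : G.DualPath s t n)
    (i : Fin (n + 1)) : Prop :=
  C.IsFCutCycle π i ∧ ∀ C' : G.DualCycle, C'.IsFCutCycle π i → C.cost c ≤ C'.cost c

end DualCycle

end PlaneGraph

namespace PlaneGraph

open Relation

variable {D : Type*} {G : PlaneGraph D}

/-! The proof uncrosses the two cycles by submodularity of cuts. Let `A`, `B` be the sets of
vertices of `G` inside `Ci`, `Cj`; both contain `s` and miss `t`. The cuts of `A ∩ B` and `A ∪ B`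
together cost at most `Ci` and `Cj` together.

A set containing `s` but not `t` has a `hull`, connected and with connected complement, whose cut
lies in that of the set and is a single dual cycle (`exists_dualCycle_hull`). This gives `C₁` from
`A ∩ B` and `C₂` from `A ∪ B`. As `C₂` is again an `f j`-cut-cycle, it costs at least `Cj`, so `C₁`
costs at most `Ci`. As `C₁` is the boundary of a set inside both cycles, it lies in the interior of
`Cj` and meets no path face beyond `f i` (`IsFCutCycle.exists_uncrossed`). Descent on the index then
makes the cycle minimum.

Planarity enters through `PlaneGraph.exists_potential`: by Euler's formula a dual cycle is the
coboundary of a potential on the vertices, which replaces the Jordan curve theorem. -/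

theorem vertexOf_facePerm (d : D) : G.vertexOf (G.facePerm d) = G.vertexOf (G.rev d) :=
  Quotient.sound ⟨1, by simp [facePerm]⟩

theorem faceOf_facePerm (d : D) : G.faceOf (G.facePerm d) = G.faceOf d :=
  Quotient.sound (Equiv.Perm.sameCycle_apply_left.2 (Equiv.Perm.SameCycle.refl _ _))

theorem vertexOf_rot (d : D) : G.vertexOf (G.rot d) = G.vertexOf d :=
  Quotient.sound (Equiv.Perm.sameCycle_apply_left.2 (Equiv.Perm.SameCycle.refl _ _))

theorem edgeOf_rev (d : D) : G.edgeOf (G.rev d) = G.edgeOf d :=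
  Quotient.sound (Equiv.Perm.sameCycle_apply_left.2 (Equiv.Perm.SameCycle.refl _ _))

theorem edgeOf_eq_iff {a b : D} : G.edgeOf a = G.edgeOf b ↔ a = b ∨ a = G.rev b := by
  constructor
  · intro h
    obtain ⟨k, hk⟩ : G.rev.SameCycle a b := Quotient.exact h
    have h2 : G.rev * G.rev = 1 := Equiv.ext G.rev_rev
    rcases Int.even_or_odd' k with ⟨m, rfl | rfl⟩
    · left
      rw [zpow_mul, zpow_ofNat, pow_two, h2, one_zpow] at hk
      exact hk
    · right
      rw [zpow_add, zpow_mul, zpow_ofNat, pow_two, h2, one_zpow, one_mul, zpow_one] at hk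
      rw [← hk, G.rev_rev]
  · rintro (rfl | rfl)
    · rfl
    · exact edgeOf_rev b

/-- A property of darts that is preserved along faces holds around a whole face. -/
theorem face_induction [Finite D] {P : D → Prop} (h : ∀ d, P d → P (G.facePerm d)) {a b : D}
    (hab : G.faceOf a = G.faceOf b) (ha : P a) : P b := by
  obtain ⟨k, -, hk⟩ := Equiv.Perm.SameCycle.exists_pow_eq' (Quotient.exact hab : G.facePerm.SameCycle a b)
  rw [← hk]
  clear hk hab
  induction k with
  | zero => exact ha
  | succ k ih => rw [pow_succ', Equiv.Perm.mul_apply]; exact h _ ih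

theorem dart_induction {P : D → Prop} (hrot : ∀ d, P (G.rot d) ↔ P d)
    (hrev : ∀ d, P (G.rev d) ↔ P d) {a : D} (ha : P a) (b : D) : P b := by
  obtain ⟨g, hg, rfl⟩ := G.connected a b
  have key : ∀ d, P (g d) ↔ P d := by
    induction hg using Subgroup.closure_induction with
    | mem x hx =>
      rcases hx with rfl | rfl
      · exact hrot
      · exact hrev
    | one => exact fun d => Iff.rfl
    | mul x y _ _ hx hy => exact fun d => (hx (y d)).trans (hy d)
    | inv x _ hx => exact fun d => by simpa using (hx (x⁻¹ d)).symm
  exact (key a).2 ha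

/-- A set of vertices closed under adjacency is everything. -/
theorem vertex_induction {Q : Set G.Vertex}
    (h : ∀ d, G.vertexOf d ∈ Q → G.vertexOf (G.rev d) ∈ Q) {u : G.Vertex} (hu : u ∈ Q)
    (v : G.Vertex) : v ∈ Q := by
  induction u using Quotient.inductionOn with | _ a
  induction v using Quotient.inductionOn with | _ b
  refine dart_induction (G := G) (P := fun d => G.vertexOf d ∈ Q)
    (fun d => by rw [vertexOf_rot]) (fun d => ⟨fun hd => ?_, h d⟩) hu b
  simpa only [G.rev_rev] using h _ hd

/-! ### Vanishing cohomology of the sphere, by counting dimensions -/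

section Exactness

open Module

variable (G)

/-- The difference along each dart of a function on the vertices. -/
def coboundary : (G.Vertex → ℚ) →ₗ[ℚ] (D → ℚ) :=
  LinearMap.funLeft ℚ ℚ (fun d => G.vertexOf (G.rev d)) - LinearMap.funLeft ℚ ℚ G.vertexOf

/-- The functions on darts that change sign under reversal. -/
def chains : Submodule ℚ (D → ℚ) where
  carrier := {h | ∀ d, h (G.rev d) = -h d}
  add_mem' := fun ha hb d => by simp only [Pi.add_apply, ha d, hb d]; ring
  zero_mem' := fun d => by simp
  smul_mem' := fun r h hh d => by simp [hh d]

open Classical in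
/-- The sums around the faces of a function on darts. -/
noncomputable def faceSum [Fintype D] : (D → ℚ) →ₗ[ℚ] (G.Face → ℚ) where
  toFun h f := ∑ d with G.faceOf d = f, h d
  map_add' a b := by ext f; simp [Finset.sum_add_distrib]
  map_smul' r a := by ext f; simp [Finset.mul_sum]

variable {G}

theorem coboundary_apply (p : G.Vertex → ℚ) (d : D) :
    G.coboundary p d = p (G.vertexOf (G.rev d)) - p (G.vertexOf d) := rfl

theorem coboundary_mem_chains (p : G.Vertex → ℚ) : G.coboundary p ∈ G.chains := by
  intro d
  simp only [coboundary_apply, G.rev_rev]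
  ring

theorem faceSum_coboundary [Fintype D] (p : G.Vertex → ℚ) : G.faceSum (G.coboundary p) = 0 := by
  classical
  ext f
  simp only [faceSum, LinearMap.coe_mk, AddHom.coe_mk, coboundary_apply, Pi.zero_apply,
    Finset.sum_sub_distrib]
  rw [sub_eq_zero]
  refine Finset.sum_equiv G.facePerm (fun d => ?_) (fun d _ => ?_)
  · simp [faceOf_facePerm]
  · rw [vertexOf_facePerm]

theorem finrank_ker_coboundary_le [Finite D] : finrank ℚ (LinearMap.ker G.coboundary) ≤ 1 := by
  have hle : LinearMap.ker G.coboundary ≤ Submodule.span ℚ {(1 : G.Vertex → ℚ)} := by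
    intro p hp
    rw [LinearMap.mem_ker] at hp
    rw [Submodule.mem_span_singleton]
    rcases isEmpty_or_nonempty G.Vertex with hV | ⟨⟨v⟩⟩
    · exact ⟨0, Subsingleton.elim _ _⟩
    · refine ⟨p v, funext fun w => ?_⟩
      have hw : w ∈ {w | p w = p v} := by
        refine vertex_induction (Q := {w | p w = p v}) (fun d hd => ?_) (u := v) rfl w
        have := congrFun hp d
        rw [coboundary_apply, Pi.zero_apply, sub_eq_zero] at this
        exact this.trans hd
      simpa using hw.symm
  calc finrank ℚ (LinearMap.ker G.coboundary)
      ≤ finrank ℚ (Submodule.span ℚ {(1 : G.Vertex → ℚ)}) := Submodule.finrank_mono hle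
    _ ≤ 1 := by simpa using finrank_span_le_card (R := ℚ) {(1 : G.Vertex → ℚ)}

theorem finrank_chains_le [Finite D] : finrank ℚ G.chains ≤ Nat.card G.Edge := by
  have := Fintype.ofFinite G.Edge
  let φ : G.chains →ₗ[ℚ] (G.Edge → ℚ) :=
    (LinearMap.funLeft ℚ ℚ (fun e : G.Edge => e.out)).comp G.chains.subtype
  have hφ : Function.Injective φ := by
    rw [← LinearMap.ker_eq_bot, LinearMap.ker_eq_bot']
    rintro ⟨h, hh⟩ h0
    ext d
    have hd : h (G.edgeOf d).out = 0 := congrFun h0 (G.edgeOf d)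
    have he : G.edgeOf (G.edgeOf d).out = G.edgeOf d := Quotient.out_eq _
    rcases edgeOf_eq_iff.1 he with h1 | h1
    · rw [h1] at hd
      exact hd
    · rw [h1, hh] at hd
      exact neg_eq_zero.1 hd
  have := LinearMap.finrank_le_finrank_of_injective hφ
  rwa [finrank_fintype_fun_eq_card, ← Nat.card_eq_fintype_card] at this

-- The image contains the difference of the indicators of any two adjacent faces. Since the dual
-- graph is connected, a single further indicator suffices to span all functions on faces.
open Classical in
theorem card_face_le [Fintype D] :
    Nat.card G.Face ≤ finrank ℚ (LinearMap.range (G.faceSum.domRestrict G.chains)) + 1 := by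
  have := Fintype.ofFinite G.Face
  rcases isEmpty_or_nonempty D with hD | ⟨⟨a⟩⟩
  · have : IsEmpty G.Face := ⟨fun f => f.inductionOn hD.elim⟩
    simp
  set R := LinearMap.range (G.faceSum.domRestrict G.chains)
  set W := R ⊔ Submodule.span ℚ {(Pi.single (G.faceOf a) 1 : G.Face → ℚ)} with hW
  have hrev (d : D) (hd : (Pi.single (G.faceOf d) 1 : G.Face → ℚ) ∈ W) :
      (Pi.single (G.faceOf (G.rev d)) 1 : G.Face → ℚ) ∈ W := by
    have hx : (Pi.single (G.rev d) 1 - Pi.single d 1 : D → ℚ) ∈ G.chains := by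
      intro x
      simp only [Pi.sub_apply, Pi.single_apply, EmbeddingLike.apply_eq_iff_eq]
      have : G.rev x = d ↔ x = G.rev d :=
        ⟨fun h => by rw [← h, G.rev_rev], fun h => by rw [h, G.rev_rev]⟩
      simp only [this]
      ring
    have hs (y : D) : G.faceSum (Pi.single y 1) = Pi.single (G.faceOf y) 1 := by
      ext f
      simp only [faceSum, LinearMap.coe_mk, AddHom.coe_mk, Pi.single_apply]
      rw [Finset.sum_ite_eq']
      simp [eq_comm]
    have hr : (Pi.single (G.faceOf (G.rev d)) 1 - Pi.single (G.faceOf d) 1 : G.Face → ℚ) ∈ W :=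
      Submodule.mem_sup_left ⟨⟨_, hx⟩, by simp [LinearMap.domRestrict_apply, hs]⟩
    simpa using W.add_mem hr hd
  have hrev' (d : D) : (Pi.single (G.faceOf (G.rev d)) 1 : G.Face → ℚ) ∈ W ↔
      (Pi.single (G.faceOf d) 1 : G.Face → ℚ) ∈ W :=
    ⟨fun h => by simpa only [G.rev_rev] using hrev _ h, hrev d⟩
  have hall (b : D) : (Pi.single (G.faceOf b) 1 : G.Face → ℚ) ∈ W := by
    refine dart_induction (G := G) (P := fun d => (Pi.single (G.faceOf d) 1 : G.Face → ℚ) ∈ W)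
      (fun d => ?_) hrev' (a := a)
      (Submodule.mem_sup_right (Submodule.mem_span_singleton_self _)) b
    have : G.facePerm (G.rev (G.rot d)) = d := by simp [facePerm, G.rev_rev]
    rw [← hrev' (G.rot d), ← faceOf_facePerm, this]
  have htop : W = ⊤ := by
    rw [eq_top_iff, ← (Pi.basisFun ℚ G.Face).span_eq, Submodule.span_le]
    rintro _ ⟨f, rfl⟩
    induction f using Quotient.inductionOn with | _ b
    rw [Pi.basisFun_apply]
    exact hall b
  have h1 := Submodule.finrank_add_le_finrank_add_finrank R
    (Submodule.span ℚ {(Pi.single (G.faceOf a) 1 : G.Face → ℚ)})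
  have h2 : finrank ℚ (Submodule.span ℚ {(Pi.single (G.faceOf a) 1 : G.Face → ℚ)}) ≤ 1 := by
    simpa using finrank_span_le_card (R := ℚ) {(Pi.single (G.faceOf a) 1 : G.Face → ℚ)}
  rw [← hW, htop, finrank_top, finrank_fintype_fun_eq_card, ← Nat.card_eq_fintype_card] at h1
  omega

/-- The first cohomology of the sphere vanishes: a chain with zero sums around the faces is a
coboundary. -/
theorem exists_potential [Fintype D] {h : D → ℚ} (hh : h ∈ G.chains) (h0 : G.faceSum h = 0) :
    ∃ p : G.Vertex → ℚ, G.coboundary p = h := by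
  have := Fintype.ofFinite G.Vertex
  let δ : (G.Vertex → ℚ) →ₗ[ℚ] G.chains := G.coboundary.codRestrict G.chains coboundary_mem_chains
  let bd := G.faceSum.domRestrict G.chains
  have hle : LinearMap.range δ ≤ LinearMap.ker bd := by
    rintro _ ⟨p, rfl⟩
    exact faceSum_coboundary p
  have h1 := LinearMap.finrank_range_add_finrank_ker δ
  have h2 := LinearMap.finrank_range_add_finrank_ker bd
  have h3 : finrank ℚ (LinearMap.ker δ) ≤ 1 := by
    rw [LinearMap.ker_codRestrict]
    exact finrank_ker_coboundary_le
  have h4 := finrank_chains_le (G := G)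
  have h5 : Nat.card G.Face ≤ finrank ℚ (LinearMap.range bd) + 1 := card_face_le
  have h6 : Nat.card G.Vertex + Nat.card G.Face = Nat.card G.Edge + 2 := G.euler
  rw [finrank_fintype_fun_eq_card, ← Nat.card_eq_fintype_card] at h1
  -- The coboundaries have dimension at least V - 1, the kernel of the face sums at most E - (F -
  -- 1), and these bounds agree by Euler's formula.
  have heq := Submodule.eq_of_le_of_finrank_le hle (by omega)
  have hmem : (⟨h, hh⟩ : G.chains) ∈ LinearMap.range δ := by
    rw [heq]
    exact h0
  obtain ⟨p, hp⟩ := hmem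
  exact ⟨p, congrArg Subtype.val hp⟩

end Exactness

/-! ### Dual cycles as chains -/

namespace DualCycle

open Classical in
/-- A dual cycle as a chain: `1` on its darts and `-1` on their reverses. -/
noncomputable def chain (C : G.DualCycle) (d : D) : ℚ :=
  ∑ m, ((if C.dart m = d then 1 else 0) - (if C.dart m = G.rev d then 1 else 0))

theorem chain_mem_chains (C : G.DualCycle) : C.chain ∈ G.chains := by
  intro d
  unfold chain
  rw [G.rev_rev d]
  simp only [← Finset.sum_neg_distrib, neg_sub]

theorem faceSum_chain [Fintype D] (C : G.DualCycle) : G.faceSum C.chain = 0 := by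
  classical
  ext f
  have hrev (m : Fin (C.n + 1)) (d : D) : C.dart m = G.rev d ↔ G.rev (C.dart m) = d :=
    ⟨fun h => by rw [h, G.rev_rev], fun h => by rw [← h, G.rev_rev]⟩
  simp only [faceSum, LinearMap.coe_mk, AddHom.coe_mk, chain, Pi.zero_apply]
  rw [Finset.sum_comm]
  simp only [Finset.sum_sub_distrib, hrev, Finset.sum_ite_eq, Finset.mem_filter, Finset.mem_univ,
    true_and]
  rw [sub_eq_zero]
  refine (Fintype.sum_equiv (Equiv.addRight 1) _ _ fun m => ?_).symm
  rw [Equiv.coe_addRight, C.closed]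

theorem chain_dart (C : G.DualCycle) (m : Fin (C.n + 1)) : C.chain (C.dart m) = 1 := by
  classical
  have hinj : Function.Injective C.dart := fun a b h => C.edges_inj (congrArg G.edgeOf h)
  have hne (k) : C.dart k ≠ G.rev (C.dart m) := by
    intro h
    have hk : k = m := C.edges_inj (by simp only [h, edgeOf_rev])
    subst hk
    exact G.rev_ne _ h.symm
  simp [chain, hne, hinj.eq_iff]

theorem chain_ne_zero_iff (C : G.DualCycle) {d : D} : C.chain d ≠ 0 ↔ G.edgeOf d ∈ C.edges := by
  classical
  constructor
  · intro h
    obtain ⟨m, -, hm⟩ := Finset.exists_ne_zero_of_sum_ne_zero h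
    refine ⟨m, ?_⟩
    by_cases h1 : C.dart m = d
    · simp only [h1]
    · by_cases h2 : C.dart m = G.rev d
      · simp only [h2, edgeOf_rev]
      · simp [h1, h2] at hm
  · rintro ⟨m, hm⟩
    rcases edgeOf_eq_iff.1 hm.symm with rfl | rfl
    · rw [chain_dart]
      exact one_ne_zero
    · rw [C.chain_mem_chains, chain_dart]
      norm_num

theorem exists_potential [Finite D] (C : G.DualCycle) :
    ∃ p : G.Vertex → ℚ, ∀ d, p (G.vertexOf (G.rev d)) - p (G.vertexOf d) = C.chain d := by
  have := Fintype.ofFinite D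
  obtain ⟨p, hp⟩ := PlaneGraph.exists_potential C.chain_mem_chains C.faceSum_chain
  exact ⟨p, congrFun hp⟩

theorem faceOf_mem_faces {C : G.DualCycle} {d : D} (h : G.edgeOf d ∈ C.edges) :
    G.faceOf d ∈ C.faces := by
  obtain ⟨m, hm⟩ := h
  rcases edgeOf_eq_iff.1 hm.symm with rfl | rfl
  · exact ⟨m, rfl⟩
  · exact ⟨m + 1, (C.closed m).symm⟩

/-- No simple cycle properly contains another one. -/
theorem edges_eq_of_subset [Finite D] {C C' : G.DualCycle} (h : C'.edges ⊆ C.edges) :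
    C'.edges = C.edges := by
  classical
  have := Fintype.ofFinite D
  refine h.antisymm ?_
  -- The chain of `C'` sums to zero around the face between darts `m` and `m + 1`, so a second dart
  -- there carries it. That dart lies on an edge of `C`, and simplicity of `C` leaves only `C.dart
  -- (m + 1)`.
  have hstep (m) (hm : G.edgeOf (C.dart m) ∈ C'.edges) : G.edgeOf (C.dart (m + 1)) ∈ C'.edges := by
    have hne : C'.chain (G.rev (C.dart m)) ≠ 0 := by rwa [chain_ne_zero_iff, edgeOf_rev]
    have hsum := congrFun C'.faceSum_chain (G.faceOf (G.rev (C.dart m)))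
    simp only [faceSum, LinearMap.coe_mk, AddHom.coe_mk, Pi.zero_apply] at hsum
    obtain ⟨d, hd, hdne, hd0⟩ : ∃ d, G.faceOf d = G.faceOf (G.rev (C.dart m)) ∧
        d ≠ G.rev (C.dart m) ∧ C'.chain d ≠ 0 := by
      by_contra! hcon
      rw [Finset.sum_eq_single_of_mem (G.rev (C.dart m)) (by simp)
        (fun d hd hdne => hcon d (by simpa using hd) hdne)] at hsum
      exact hne hsum
    rw [chain_ne_zero_iff] at hd0
    obtain ⟨k, hk⟩ := h hd0
    rcases edgeOf_eq_iff.1 hk.symm with rfl | rfl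
    · have : k = m + 1 := C.faces_inj (hd.trans (C.closed m))
      rwa [← this]
    · have : k + 1 = m + 1 := C.faces_inj ((C.closed k).symm.trans (hd.trans (C.closed m)))
      exact absurd (congrArg (fun m => G.rev (C.dart m)) (add_right_cancel this)) hdne
  obtain ⟨m₀, hm₀⟩ := h ⟨0, rfl⟩
  have hstart : G.edgeOf (C.dart m₀) ∈ C'.edges := by
    simp only at hm₀
    rw [hm₀]
    exact ⟨0, rfl⟩
  have hall (k : ℕ) : G.edgeOf (C.dart (m₀ + Fin.ofNat _ k)) ∈ C'.edges := by
    induction k with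
    | zero => simpa using hstart
    | succ k ih =>
      have : Fin.ofNat (C.n + 1) (k + 1) = Fin.ofNat (C.n + 1) k + 1 := by
        simp [Fin.ext_iff, Fin.val_add]
      rw [this, ← add_assoc]
      exact hstep _ ih
  rintro _ ⟨m, rfl⟩
  simpa using hall (m - m₀).val

end DualCycle

/-! ### Directed cuts and the dual cycles in them -/

/-- The darts that leave a set of vertices. -/
def cutDarts (A : Set G.Vertex) : Set D :=
  {d | G.vertexOf d ∈ A ∧ G.vertexOf (G.rev d) ∉ A}

theorem exists_mem_cutDarts_face [Finite D] {A : Set G.Vertex} {a b : D}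
    (hab : G.faceOf a = G.faceOf b) (ha : G.vertexOf a ∈ A) (hb : G.vertexOf b ∉ A) :
    ∃ d ∈ cutDarts A, G.faceOf d = G.faceOf a := by
  by_contra! hcon
  refine hb (face_induction (P := fun d => G.vertexOf d ∈ A ∧ G.faceOf d = G.faceOf a)
    (fun d hd => ⟨?_, ?_⟩) hab ⟨ha, rfl⟩).1
  · rw [vertexOf_facePerm]
    by_contra h
    exact hcon d ⟨hd.1, h⟩ hd.2
  · rw [faceOf_facePerm, hd.2]

/-- The face on the other side of `d` has `G.rev d` entering `A`, so a tour of that face must leave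
`A` again. -/
theorem exists_next_cutDart [Finite D] {A : Set G.Vertex} {d : D} (hd : d ∈ cutDarts A) :
    ∃ d' ∈ cutDarts A, G.faceOf (G.rev d) = G.faceOf d' := by
  have h : G.faceOf (G.facePerm (G.rev d)) = G.faceOf (G.rev d) := faceOf_facePerm _
  obtain ⟨d', h1, h2⟩ := exists_mem_cutDarts_face (A := A) h
    (by rw [vertexOf_facePerm, G.rev_rev]; exact hd.1) hd.2
  exact ⟨d', h1, (h2.trans h).symm⟩

/-- Every nonempty directed cut contains a dual cycle. -/
theorem exists_dualCycle_of_cutDarts [Finite D] {A : Set G.Vertex} (hA : (cutDarts A).Nonempty) :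
    ∃ C : G.DualCycle, ∀ m, C.dart m ∈ cutDarts A := by
  classical
  obtain ⟨d₀, hd₀⟩ := hA
  have hnext (d : cutDarts A) : ∃ d' : cutDarts A, G.faceOf (G.rev d) = G.faceOf (d' : D) := by
    obtain ⟨d', h1, h2⟩ := exists_next_cutDart d.2
    exact ⟨⟨d', h1⟩, h2⟩
  choose next hnext using hnext
  let w (k : ℕ) : cutDarts A := next^[k] ⟨d₀, hd₀⟩
  have hw (k : ℕ) : G.faceOf (G.rev (w k)) = G.faceOf (w (k + 1) : D) := by
    simp only [w, Function.iterate_succ_apply']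
    exact hnext _
  have hex : ∃ N, ∃ a, a < N ∧ G.faceOf (w a : D) = G.faceOf (w N : D) := by
    obtain ⟨a, b, hab, h⟩ := Finite.exists_ne_map_eq_of_infinite fun k => G.faceOf (w k : D)
    rcases lt_or_gt_of_ne hab with hlt | hlt
    · exact ⟨b, a, hlt, h⟩
    · exact ⟨a, b, hlt, h.symm⟩
  -- `N` is the first time the walk revisits a face, so steps `a, …, N - 1` form a simple cycle.
  obtain ⟨a, haN, ha⟩ := Nat.find_spec hex
  set N := Nat.find hex
  have hmin {x y : ℕ} (hxy : x < y) (hy : y < N) : G.faceOf (w x : D) ≠ G.faceOf (w y : D) :=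
    fun h => Nat.find_min hex hy ⟨x, hxy, h⟩
  have hinj : Function.Injective fun m : Fin (N - a - 1 + 1) => G.faceOf (w (a + m) : D) := by
    intro x y hxy
    have hx := x.2
    have hy := y.2
    rcases lt_trichotomy (x : ℕ) y with h | h | h
    · exact absurd hxy (hmin (by omega) (by omega))
    · exact Fin.ext h
    · exact absurd hxy.symm (hmin (by omega) (by omega))
  refine ⟨⟨N - a - 1, fun m => w (a + m), fun m => ?_, hinj, fun x y hxy => ?_⟩, fun m => (w _).2⟩
  · rw [hw]
    rcases eq_or_ne m (Fin.last _) with rfl | hm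
    · have : a + (Fin.last (N - a - 1) : ℕ) + 1 = N := by simp; omega
      rw [this, ← ha, Fin.last_add_one]
      simp
    · rw [Fin.val_add_one_of_lt (Fin.lt_last_iff_ne_last.2 hm), add_assoc]
  · rcases edgeOf_eq_iff.1 hxy with h | h
    · exact hinj (congrArg G.faceOf h)
    · refine absurd (w (a + x)).2.1 ?_
      rw [h]
      exact (w (a + y)).2.2

/-! ### Components, hulls and their boundaries -/

/-- The vertices that can be reached from `x` by a walk whose later vertices all lie in `U`. -/
def component (U : Set G.Vertex) (x : G.Vertex) : Set G.Vertex :=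
  {v | ReflTransGen (fun a b => b ∈ U ∧ ∃ d, G.vertexOf d = a ∧ G.vertexOf (G.rev d) = b) x v}

section Component

variable {U Q : Set G.Vertex} {x : G.Vertex} {d : D}

theorem mem_component_self : x ∈ component U x := ReflTransGen.refl

theorem mem_component_of_adj (h : G.vertexOf d ∈ component U x) (hU : G.vertexOf (G.rev d) ∈ U) :
    G.vertexOf (G.rev d) ∈ component U x :=
  ReflTransGen.tail h ⟨hU, d, rfl, rfl⟩

theorem mem_component_of_adj' (h : G.vertexOf (G.rev d) ∈ component U x) (hU : G.vertexOf d ∈ U) :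
    G.vertexOf d ∈ component U x := by
  have := mem_component_of_adj (d := G.rev d) h
  rw [G.rev_rev] at this
  exact this hU

theorem component_subset (hx : x ∈ Q)
    (h : ∀ d, G.vertexOf d ∈ Q → G.vertexOf (G.rev d) ∈ U → G.vertexOf (G.rev d) ∈ Q) :
    component U x ⊆ Q := by
  intro v hv
  induction hv with
  | refl => exact hx
  | tail _ hbc ih =>
    obtain ⟨hU, d, rfl, rfl⟩ := hbc
    exact h d ih hU

theorem component_subset_self (hx : x ∈ U) : component U x ⊆ U :=
  component_subset hx fun _ _ h => h

theorem cutDarts_component_subset (hx : x ∈ U) : cutDarts (component U x) ⊆ cutDarts U :=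
  fun _ hd => ⟨component_subset_self hx hd.1, fun h => hd.2 (mem_component_of_adj hd.1 h)⟩

theorem cutDarts_nonempty {A : Set G.Vertex} {s t : G.Vertex} (hs : s ∈ A) (ht : t ∉ A) :
    (cutDarts A).Nonempty := by
  by_contra hcon
  refine ht (vertex_induction (fun d hd => ?_) hs t)
  by_contra h
  exact hcon ⟨d, hd, h⟩

end Component

/-- The vertices separated from `t` by the component of `t` in the complement of `A`, on the side
of `s`. -/
def hull (A : Set G.Vertex) (s t : G.Vertex) : Set G.Vertex :=
  component (component Aᶜ t)ᶜ s

section Hull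

variable {A : Set G.Vertex} {s t : G.Vertex}

theorem component_compl_subset (ht : t ∉ A) : component Aᶜ t ⊆ Aᶜ :=
  component_subset_self ht

theorem not_mem_component_compl (hs : s ∈ A) (ht : t ∉ A) : s ∈ (component Aᶜ t)ᶜ :=
  fun h => component_compl_subset ht h hs

theorem hull_subset (hs : s ∈ A) (ht : t ∉ A) : hull A s t ⊆ (component Aᶜ t)ᶜ :=
  component_subset_self (not_mem_component_compl hs ht)

/-- A dart leaving the hull must end in the component of `t`. If it started outside `A`, its origin
would belong to that component too, which the hull avoids. -/
theorem cutDarts_hull_subset (hs : s ∈ A) (ht : t ∉ A) : cutDarts (hull A s t) ⊆ cutDarts A := by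
  intro d hd
  have h1 : G.vertexOf (G.rev d) ∈ component Aᶜ t := by
    by_contra h
    exact hd.2 (mem_component_of_adj hd.1 h)
  refine ⟨?_, component_compl_subset ht h1⟩
  by_contra h
  exact hull_subset hs ht hd.1 (mem_component_of_adj' h1 h)

/-- Every vertex outside the hull but adjacent to it lies in the component of `t` in `Aᶜ`. Hence the
hull and the component of `t` outside it are together closed under adjacency, and `G` is connected.
-/
theorem component_compl_hull (hs : s ∈ A) (ht : t ∉ A) :
    (hull A s t)ᶜ ⊆ component (hull A s t)ᶜ t := by
  have hT : component Aᶜ t ⊆ (hull A s t)ᶜ := fun v hv h => hull_subset hs ht h hv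
  have hTQ : component Aᶜ t ⊆ component (hull A s t)ᶜ t := by
    intro v hv
    induction hv with
    | refl => exact mem_component_self
    | tail hb hbc ih => exact ih.tail ⟨hT (hb.tail hbc), hbc.2⟩
  have hrev (d : D) (hd : G.vertexOf d ∉ hull A s t) (hd' : G.vertexOf (G.rev d) ∈ hull A s t) :
      G.vertexOf d ∈ component Aᶜ t := by
    by_contra h
    exact hd (mem_component_of_adj' hd' h)
  intro v hv
  by_contra hvQ
  have hall := vertex_induction (Q := hull A s t ∪ component (hull A s t)ᶜ t) (u := t)
    (fun d hd => ?_) (Or.inr mem_component_self) v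
  · exact hall.elim hv hvQ
  · by_cases h : G.vertexOf (G.rev d) ∈ hull A s t
    · exact Or.inl h
    · right
      rcases hd with hd | hd
      · exact hTQ (by simpa only [G.rev_rev] using hrev (G.rev d) h (by rwa [G.rev_rev]))
      · exact mem_component_of_adj hd h

/-- The boundary of a hull is a single dual cycle. -/
theorem exists_dualCycle_hull [Finite D] (hs : s ∈ A) (ht : t ∉ A) :
    ∃ C : G.DualCycle, (∀ m, C.dart m ∈ cutDarts (hull A s t)) ∧
      (∀ d ∈ cutDarts (hull A s t), d ∈ Set.range C.dart) ∧ C.inside t = hull A s t := by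
  set S := hull A s t with hS
  have hsS : s ∈ S := mem_component_self
  have htS : t ∉ S := fun h => hull_subset hs ht h mem_component_self
  obtain ⟨C, hC⟩ := exists_dualCycle_of_cutDarts (cutDarts_nonempty hsS htS)
  -- `p` changes only across `C`, and `S` and its complement are each connected without crossing
  -- `C`. So `p` takes one value on each, and these differ by the jump at `C.dart 0`; every dart
  -- leaving `S` therefore crosses `C`.
  obtain ⟨p, hp⟩ := C.exists_potential
  have hcut {d : D} (h : G.edgeOf d ∈ C.edges) :
      d ∈ cutDarts S ∨ G.rev d ∈ cutDarts S := by
    obtain ⟨m, hm⟩ := h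
    rcases edgeOf_eq_iff.1 hm with h | h
    · exact Or.inl (h ▸ hC m)
    · exact Or.inr (h ▸ hC m)
  have hin {d : D} (h : G.vertexOf d ∈ S ↔ G.vertexOf (G.rev d) ∈ S) : G.edgeOf d ∉ C.edges := by
    intro he
    rcases hcut he with h1 | h1
    · exact h1.2 (h.1 h1.1)
    · have := h1.2
      rw [G.rev_rev] at this
      exact this (h.2 h1.1)
  have hpe {d : D} (h : G.edgeOf d ∉ C.edges) : p (G.vertexOf (G.rev d)) = p (G.vertexOf d) := by
    rw [← DualCycle.chain_ne_zero_iff, not_not, ← hp, sub_eq_zero] at h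
    exact h
  have hpS : ∀ v ∈ S, v ∈ {v | v ∈ S ∧ p v = p s} := by
    refine component_subset ⟨hsS, rfl⟩ fun d hd hU => ?_
    have hd' := mem_component_of_adj hd.1 hU
    exact ⟨hd', (hpe (hin (iff_of_true hd.1 hd'))).trans hd.2⟩
  have hpT : ∀ v ∈ Sᶜ, v ∈ {v | v ∉ S ∧ p v = p t ∧ C.SameRegion t v} := by
    refine (component_compl_hull hs ht).trans
      (component_subset ⟨htS, rfl, ReflTransGen.refl⟩ fun d hd hU => ?_)
    have he : G.edgeOf d ∉ C.edges := hin (iff_of_false hd.1 hU)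
    exact ⟨hU, (hpe he).trans hd.2.1, hd.2.2.tail ⟨d, rfl, rfl, he⟩⟩
  refine ⟨C, hC, fun d hd => ?_, ?_⟩
  · have hne : p t ≠ p s := by
      have h1 := hp (C.dart 0)
      rw [C.chain_dart, (hpS _ (hC 0).1).2, (hpT _ (hC 0).2).2.1] at h1
      intro h
      rw [h, sub_self] at h1
      exact zero_ne_one h1
    have he : G.edgeOf d ∈ C.edges := by
      by_contra he
      have := hpe he
      rw [(hpS _ hd.1).2, (hpT _ hd.2).2.1] at this
      exact hne this
    obtain ⟨m, hm⟩ := he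
    rcases edgeOf_eq_iff.1 hm with h | h
    · exact ⟨m, h⟩
    · exact absurd (h ▸ hC m).1 hd.2
  · ext v
    refine ⟨fun hv => ?_, fun hv hr => ?_⟩
    · by_contra h
      exact hv (hpT v h).2.2
    · suffices v ∉ S from this hv
      clear hv
      induction hr with
      | refl => exact htS
      | tail _ hbc ih =>
        obtain ⟨d, rfl, rfl, he⟩ := hbc
        intro h
        have : G.rev d ∈ cutDarts S := ⟨h, by rwa [G.rev_rev]⟩
        have hpe' := hpe he
        have h1 := hp (C.dart 0)
        rw [C.chain_dart, (hpS _ (hC 0).1).2, (hpT _ (hC 0).2).2.1] at h1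
        rw [(hpS _ h).2, (hpT _ ih).2.1] at hpe'
        rw [hpe', sub_self] at h1
        exact zero_ne_one h1

end Hull

/-! ### Following the dual path back from `t` -/

section Path

variable {s t : G.Vertex} {n : ℕ}

/-- If `T` is closed under crossing edges outside `K`, it contains either all or none of the
vertices incident to a face without edges in `K`. -/
theorem vertexOf_mem_of_face [Finite D] {T : Set G.Vertex} {K : Set G.Edge}
    (hT : ∀ d, G.vertexOf d ∈ T → G.edgeOf d ∉ K → G.vertexOf (G.rev d) ∈ T) {f : G.Face}
    (hf : ∀ d, G.faceOf d = f → G.edgeOf d ∉ K) {a b : D} (ha : G.faceOf a = f)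
    (hb : G.faceOf b = f) (haT : G.vertexOf a ∈ T) : G.vertexOf b ∈ T := by
  refine (face_induction (P := fun d => G.faceOf d = f ∧ G.vertexOf d ∈ T)
    (fun d hd => ⟨?_, ?_⟩) (ha.trans hb.symm) ⟨ha, haT⟩).2
  · rw [faceOf_facePerm, hd.1]
  · rw [vertexOf_facePerm]
    exact hT d hd.2 (hf d hd.1)

/-- Following the path backwards from `t`, one stays in the region of `t` until meeting `K`. -/
theorem DualPath.exists_mem_region [Finite D] (π : G.DualPath s t n) {T : Set G.Vertex}
    {K : Set G.Edge} (ht : t ∈ T)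
    (hT : ∀ d, G.vertexOf d ∈ T → G.edgeOf d ∉ K → G.vertexOf (G.rev d) ∈ T) (i : Fin (n + 1))
    (hi : ∀ l, i < l → ∀ d, G.faceOf d = π.f l → G.edgeOf d ∉ K) :
    ∃ d, G.faceOf d = π.f i ∧ G.vertexOf d ∈ T := by
  induction i using Fin.reverseInduction with
  | last =>
    obtain ⟨d, h1, h2⟩ := π.finish
    exact ⟨d, h2, h1 ▸ ht⟩
  | cast m ih =>
    have hm : m.castSucc < m.succ := Fin.castSucc_lt_succ
    obtain ⟨a, ha, haT⟩ := ih fun l hl => hi l (hm.trans hl)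
    obtain ⟨d, h1, h2⟩ := π.adj m
    -- `G.facePerm (G.rev d)` is the dart of the later face with the same origin as `d`, so the two
    -- faces share a vertex already known to lie in `T`.
    have hd : G.faceOf (G.facePerm (G.rev d)) = π.f m.succ := by rw [faceOf_facePerm, h2]
    have := vertexOf_mem_of_face hT (hi _ hm) ha hd haT
    rw [vertexOf_facePerm, G.rev_rev] at this
    exact ⟨d, h1, this⟩

theorem DualPath.forall_mem_region [Finite D] (π : G.DualPath s t n) {T : Set G.Vertex}
    {K : Set G.Edge} (ht : t ∈ T)
    (hT : ∀ d, G.vertexOf d ∈ T → G.edgeOf d ∉ K → G.vertexOf (G.rev d) ∈ T) (i : Fin (n + 1))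
    (hi : ∀ l, i ≤ l → ∀ d, G.faceOf d = π.f l → G.edgeOf d ∉ K) (d : D)
    (hd : G.faceOf d = π.f i) : G.vertexOf d ∈ T := by
  obtain ⟨a, ha, haT⟩ := π.exists_mem_region ht hT i fun l hl => hi l hl.le
  exact vertexOf_mem_of_face hT (hi i le_rfl) ha hd haT

end Path

/-! ### Cut-cycles, their position on the path and their cost -/

namespace DualCycle

variable {s t : G.Vertex} {n : ℕ}

theorem not_mem_inside_self (C : G.DualCycle) : t ∉ C.inside t := fun h => h ReflTransGen.refl

theorem isCutCycle_iff (C : G.DualCycle) : C.IsCutCycle s t ↔ s ∈ C.inside t := by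
  have h (v : G.Vertex) : Cell.dualFace v ∈ C.interior t ↔ v ∈ C.inside t := by
    simp [interior, cells]
  rw [IsCutCycle, h, h]
  exact and_iff_left C.not_mem_inside_self

theorem rev_not_mem_inside (C : G.DualCycle) {d : D} (hd : G.vertexOf d ∉ C.inside t)
    (he : G.edgeOf d ∉ C.edges) : G.vertexOf (G.rev d) ∉ C.inside t := by
  intro h
  exact h ((not_not.1 hd).tail ⟨d, rfl, rfl, he⟩)

theorem edgeOf_mem_of_cutDarts (C : G.DualCycle) {d : D} (hd : d ∈ cutDarts (C.inside t)) :
    G.edgeOf d ∈ C.edges := by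
  by_contra he
  have := C.rev_not_mem_inside (d := G.rev d) hd.2 (by rwa [edgeOf_rev])
  rw [G.rev_rev] at this
  exact this hd.1

/-- All faces of the path after the last one on `C` lie outside `C`. -/
theorem IsFCutCycle.not_mem_inside [Finite D] {C : G.DualCycle} {π : G.DualPath s t n}
    {i : Fin (n + 1)} (hC : C.IsFCutCycle π i) {l : Fin (n + 1)} (hl : i < l) {d : D}
    (hd : G.faceOf d = π.f l) : G.vertexOf d ∉ C.inside t := by
  refine π.forall_mem_region (T := (C.inside t)ᶜ) (K := C.edges) C.not_mem_inside_self
    (fun d h he => C.rev_not_mem_inside h he) l (fun l' hl' a ha he => ?_) d hd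
  have := faceOf_mem_faces he
  rw [ha] at this
  exact hC.2.2 l' (hl.trans_le hl') this

/-- A cut-cycle meets the path. -/
theorem IsCutCycle.exists_isFCutCycle [Finite D] {C : G.DualCycle} (hC : C.IsCutCycle s t)
    (π : G.DualPath s t n) : ∃ i, C.IsFCutCycle π i := by
  have hne : {l | π.f l ∈ C.faces}.Nonempty := by
    by_contra hcon
    obtain ⟨d, hd, hd'⟩ := π.start
    refine π.forall_mem_region (T := (C.inside t)ᶜ) (K := C.edges) C.not_mem_inside_self
      (fun d h he => C.rev_not_mem_inside h he) 0 (fun l _ a ha he => hcon ⟨l, ?_⟩) d hd' ?_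
    · have := faceOf_mem_faces he
      rwa [ha] at this
    · rw [hd]
      exact C.isCutCycle_iff.1 hC
  obtain ⟨i, hi, hmax⟩ := Set.exists_max_image _ id (Set.toFinite _) hne
  exact ⟨i, hC, hi, fun l hl h => (hmax l h).not_gt hl⟩

open Classical in
theorem cost_eq_sum_edges [Fintype G.Edge] (C : G.DualCycle) (c : G.Edge → ℝ) :
    C.cost c = ∑ e with e ∈ C.edges, c e := by
  refine Finset.sum_bij (fun m _ => G.edgeOf (C.dart m)) (fun m _ => ?_)
    (fun a _ b _ h => C.edges_inj h) (fun e he => ?_) (fun _ _ => rfl)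
  · simp [edges]
  · simpa [edges] using he

/-- If there is a cut-cycle for `f i`, then there is a minimum one. -/
theorem IsFCutCycle.exists_isMinFCutCycle [Finite D] {C : G.DualCycle} {π : G.DualPath s t n}
    {i : Fin (n + 1)} (hC : C.IsFCutCycle π i) (c : G.Edge → ℝ) :
    ∃ C' : G.DualCycle, C'.IsMinFCutCycle c π i := by
  classical
  have := Fintype.ofFinite G.Edge
  -- The cost depends only on the edge set, and there are finitely many edge sets.
  obtain ⟨E, ⟨C', hC', rfl⟩, hmin⟩ := Set.exists_min_image
    (edges '' {C : G.DualCycle | C.IsFCutCycle π i}) (fun E => ∑ e with e ∈ E, c e)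
    (Set.toFinite _) ⟨_, C, hC, rfl⟩
  refine ⟨C', hC', fun C'' hC'' => ?_⟩
  rw [cost_eq_sum_edges, cost_eq_sum_edges]
  exact hmin _ ⟨C'', hC'', rfl⟩

open Classical in
theorem cost_le_sum_cutDarts [Fintype D] {C : G.DualCycle} {A : Set G.Vertex} {c : G.Edge → ℝ}
    (hc : ∀ e, 0 ≤ c e) (hC : ∀ m, C.dart m ∈ cutDarts A) :
    C.cost c ≤ ∑ d with d ∈ cutDarts A, c (G.edgeOf d) := by
  have hinj : Function.Injective C.dart := fun a b h => C.edges_inj (congrArg G.edgeOf h)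
  calc C.cost c = ∑ d ∈ Finset.univ.image C.dart, c (G.edgeOf d) :=
        (Finset.sum_image (f := fun d => c (G.edgeOf d)) fun a _ b _ h => hinj h).symm
    _ ≤ _ := Finset.sum_le_sum_of_subset_of_nonneg
        (fun d hd => by
          obtain ⟨m, -, rfl⟩ := Finset.mem_image.1 hd
          simpa using hC m)
        (fun _ _ _ => hc _)

-- An edge has at most one dart leaving the inside, and such an edge lies on `C`. Only this
-- inequality is needed for uncrossing.
open Classical in
theorem sum_cutDarts_inside_le_cost [Fintype D] (C : G.DualCycle) {c : G.Edge → ℝ}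
    (hc : ∀ e, 0 ≤ c e) : ∑ d with d ∈ cutDarts (C.inside t), c (G.edgeOf d) ≤ C.cost c := by
  have := Fintype.ofFinite G.Edge
  have hinj : Set.InjOn G.edgeOf {d : D | d ∈ cutDarts (C.inside t)} := by
    intro a ha b hb h
    rcases edgeOf_eq_iff.1 h with h | h
    · exact h
    · exact absurd (h ▸ ha.1) hb.2
  rw [cost_eq_sum_edges]
  calc ∑ d with d ∈ cutDarts (C.inside t), c (G.edgeOf d)
      = ∑ e ∈ (Finset.univ.filter (· ∈ cutDarts (C.inside t))).image G.edgeOf, c e :=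
        (Finset.sum_image fun a ha b hb h => hinj (by simpa using ha) (by simpa using hb) h).symm
    _ ≤ _ := Finset.sum_le_sum_of_subset_of_nonneg
        (fun e he => by
          obtain ⟨d, hd, rfl⟩ := Finset.mem_image.1 he
          simpa using C.edgeOf_mem_of_cutDarts (by simpa using hd))
        (fun _ _ _ => hc _)

end DualCycle

/-! ### Submodularity and uncrossing -/

open Classical in
/-- The cut function is submodular. -/
theorem sum_cutDarts_inter_add_union_le [Fintype D] (A B : Set G.Vertex) {c : G.Edge → ℝ}
    (hc : ∀ e, 0 ≤ c e) :
    ∑ d with d ∈ cutDarts (A ∩ B), c (G.edgeOf d) + ∑ d with d ∈ cutDarts (A ∪ B), c (G.edgeOf d) ≤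
      ∑ d with d ∈ cutDarts A, c (G.edgeOf d) + ∑ d with d ∈ cutDarts B, c (G.edgeOf d) := by
  simp only [Finset.sum_filter, ← Finset.sum_add_distrib]
  refine Finset.sum_le_sum fun d _ => ?_
  have h := hc (G.edgeOf d)
  simp only [cutDarts, Set.mem_ofPred_eq, Set.mem_inter_iff, Set.mem_union]
  by_cases h1 : G.vertexOf d ∈ A <;> by_cases h2 : G.vertexOf d ∈ B <;>
    by_cases h3 : G.vertexOf (G.rev d) ∈ A <;> by_cases h4 : G.vertexOf (G.rev d) ∈ B <;>
    simp [h1, h2, h3, h4, h]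

namespace DualCycle

variable {s t : G.Vertex} {n : ℕ}

/-- Every face on a cut-cycle is incident to the part of the inside connected to `s`. -/
theorem IsCutCycle.exists_mem_component [Finite D] {C : G.DualCycle} (hC : C.IsCutCycle s t)
    {f : G.Face} (hf : f ∈ C.faces) :
    ∃ d, G.faceOf d = f ∧ G.vertexOf d ∈ component (C.inside t) s := by
  have hs := C.isCutCycle_iff.1 hC
  have hsub := cutDarts_component_subset hs
  obtain ⟨C', hC'⟩ := exists_dualCycle_of_cutDarts (cutDarts_nonempty
    (mem_component_self (U := C.inside t) (x := s))
    (fun h => C.not_mem_inside_self (component_subset_self hs h)))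
  -- The cut of the component of `s` consists of edges of `C`, so a cycle in it must be all of `C`.
  have heq : C'.edges = C.edges := edges_eq_of_subset (by
    rintro _ ⟨m, rfl⟩
    exact C.edgeOf_mem_of_cutDarts (hsub (hC' m)))
  obtain ⟨m, rfl⟩ := hf
  have : G.faceOf (C.dart m) ∈ C'.faces := faceOf_mem_faces (by rw [heq]; exact ⟨m, rfl⟩)
  obtain ⟨k, hk⟩ := this
  exact ⟨C'.dart k, hk, (hC' k).1⟩

/-- Uncrossing: an `f i`-cut-cycle that crosses a minimum `f j`-cut-cycle with `i < j` can be
replaced by a cut-cycle inside the latter. -/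
theorem IsFCutCycle.exists_uncrossed [Finite D] {c : G.Edge → ℝ} (hc : ∀ e, 0 ≤ c e)
    {π : G.DualPath s t n} {i j : Fin (n + 1)} (hij : i < j) {Ci Cj : G.DualCycle}
    (hCi : Ci.IsFCutCycle π i) (hCj : Cj.IsMinFCutCycle c π j) :
    ∃ i' ≤ i, ∃ C : G.DualCycle, C.IsFCutCycle π i' ∧ C.cells ⊆ Cj.interior t ∧
      C.cost c ≤ Ci.cost c := by
  classical
  have := Fintype.ofFinite D
  set A := Ci.inside t with hA
  set B := Cj.inside t with hB
  have hsA : s ∈ A := Ci.isCutCycle_iff.1 hCi.1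
  have hsB : s ∈ B := Cj.isCutCycle_iff.1 hCj.1.1
  have htA : t ∉ A := Ci.not_mem_inside_self
  have htB : t ∉ B := Cj.not_mem_inside_self
  have htI : t ∉ A ∩ B := fun h => htA h.1
  have htU : t ∉ A ∪ B := fun h => h.elim htA htB
  obtain ⟨C₁, hC₁, -, hin₁⟩ := exists_dualCycle_hull (A := A ∩ B) ⟨hsA, hsB⟩ htI
  obtain ⟨C₂, hC₂, hC₂', hin₂⟩ := exists_dualCycle_hull (A := A ∪ B) (Or.inl hsA) htU
  have hcut₁ : C₁.IsCutCycle s t := C₁.isCutCycle_iff.2 (hin₁ ▸ mem_component_self)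
  have hcut₂ : C₂.IsCutCycle s t := C₂.isCutCycle_iff.2 (hin₂ ▸ mem_component_self)
  have hsub₁ (m) : C₁.dart m ∈ cutDarts (A ∩ B) := 
    cutDarts_hull_subset (A := A ∩ B) ⟨hsA, hsB⟩ htI (hC₁ m)
  have hsub₂ (m) : C₂.dart m ∈ cutDarts (A ∪ B) := cutDarts_hull_subset (Or.inl hsA) htU (hC₂ m)
  -- The face `f j` touches the hull, through the part of `B` connected to `s`. It also touches the
  -- component of `t` outside `A ∪ B`, because the later path faces avoid both cycles. A tour of `f
  -- j` therefore crosses the boundary of the hull, which is `C₂`.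
  have hF₂ : C₂.IsFCutCycle π j := by
    refine ⟨hcut₂, ?_, fun l hl hf => ?_⟩
    · obtain ⟨a, ha, haB⟩ := hCj.1.1.exists_mem_component hCj.1.2.1
      have haS : G.vertexOf a ∈ hull (A ∪ B) s t := by
        have hBT : B ⊆ (component (A ∪ B)ᶜ t)ᶜ :=
          fun v hv h => component_compl_subset htU h (Or.inr hv)
        refine component_subset mem_component_self (fun d hd hU => ?_) haB
        exact mem_component_of_adj hd (hBT hU)
      have hclosed (d : D) (hd : G.vertexOf d ∈ component (A ∪ B)ᶜ t)
          (he : G.edgeOf d ∉ Ci.edges ∪ Cj.edges) :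
          G.vertexOf (G.rev d) ∈ component (A ∪ B)ᶜ t := by
        have hd' := component_compl_subset htU hd
        refine mem_component_of_adj hd fun h => ?_
        rcases h with h | h
        · exact Ci.rev_not_mem_inside (fun h => hd' (Or.inl h)) (fun h => he (Or.inl h)) h
        · exact Cj.rev_not_mem_inside (fun h => hd' (Or.inr h)) (fun h => he (Or.inr h)) h
      have havoid (l) (hl : j < l) (d : D) (hd : G.faceOf d = π.f l) :
          G.edgeOf d ∉ Ci.edges ∪ Cj.edges := by
        rintro (he | he)
        · exact hCi.2.2 l (hij.trans hl) (hd ▸ faceOf_mem_faces he)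
        · exact hCj.1.2.2 l hl (hd ▸ faceOf_mem_faces he)
      obtain ⟨b, hb, hbT⟩ := π.exists_mem_region mem_component_self hclosed j havoid
      obtain ⟨d, hd, hda⟩ := exists_mem_cutDarts_face (ha.trans hb.symm) haS
        (fun h => hull_subset (Or.inl hsA) htU h hbT)
      obtain ⟨m, rfl⟩ := hC₂' d hd
      exact ⟨m, hda.trans ha⟩
    · obtain ⟨m, hm⟩ := hf
      rcases (hsub₂ m).1 with h | h
      · exact hCi.not_mem_inside (hij.trans hl) hm h
      · exact hCj.1.not_mem_inside hl hm h
  obtain ⟨i', hi'⟩ := hcut₁.exists_isFCutCycle π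
  refine ⟨i', ?_, C₁, hi', ?_, ?_⟩
  · by_contra! h
    obtain ⟨m, hm⟩ := hi'.2.1
    exact hCi.not_mem_inside h hm (hsub₁ m).1.1
  -- Every dart of `C₁` starts at a vertex of `B`, so its edge and its left face belong to the
  -- interior of `Cj`.
  · rintro _ (⟨_, ⟨m, rfl⟩, rfl⟩ | ⟨_, ⟨m, rfl⟩, rfl⟩)
    · exact Or.inr (Or.inr ⟨_, ⟨_, (hsub₁ m).1.2, C₁.dart m, rfl, rfl⟩, rfl⟩)
    · exact Or.inr (Or.inl (Or.inr ⟨_, ⟨C₁.dart m, rfl, (hsub₁ m).1.2⟩, rfl⟩))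
  · have h1 := cost_le_sum_cutDarts hc hsub₁
    have h2 := cost_le_sum_cutDarts hc hsub₂
    have h3 := sum_cutDarts_inter_add_union_le A B hc
    have h4 := Ci.sum_cutDarts_inside_le_cost (t := t) hc
    have h5 := Cj.sum_cutDarts_inside_le_cost (t := t) hc
    have h6 := hCj.2 C₂ hF₂
    linarith

end DualCycle

end PlaneGraph

theorem mainTheorem7 {D : Type*} [Finite D] (G : PlaneGraph D)
    (c : G.Edge → ℝ) (hc : ∀ e, 0 ≤ c e)
    (s t : G.Vertex) (n : ℕ) (π : G.DualPath s t n)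
    (i j : Fin (n + 1)) (hij : i < j)
    (Ci Cj : G.DualCycle)
    (hCi : Ci.IsMinFCutCycle c π i) (hCj : Cj.IsMinFCutCycle c π j) :
    ∃ i' : Fin (n + 1), i' ≤ i ∧
      ∃ C : G.DualCycle, C.IsMinFCutCycle c π i' ∧
        C.cells ⊆ Cj.interior t ∧ C.cost c ≤ Ci.cost c := by
  -- If the uncrossed cycle has index `i`, it is minimum because `Ci` is. Otherwise a minimum cycle
  -- of the smaller index costs no more but need not lie inside `Cj`, so it is uncrossed in turn.
  induction i using WellFoundedLT.induction generalizing Ci with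
  | ind i ih =>
    obtain ⟨i₁, hi₁, C₁, hF₁, hcells, hcost⟩ := hCi.1.exists_uncrossed hc hij hCj
    rcases hi₁.eq_or_lt with rfl | hlt
    · exact ⟨i₁, le_rfl, C₁, ⟨hF₁, fun C' hC' => hcost.trans (hCi.2 C' hC')⟩, hcells, hcost⟩
    · obtain ⟨C', hC'⟩ := hF₁.exists_isMinFCutCycle c
      obtain ⟨i', hi', C, hC, hCcells, hCcost⟩ := ih i₁ hlt (hlt.trans hij) C' hC'
      exact ⟨i', hi'.trans hlt.le, C, hC, hCcells, hCcost.trans ((hC'.2 C₁ hF₁).trans hcost)⟩
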